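/- Let $(X,G)$ be a compact structure: $X$ is a compact metric space and $G$ is a compact Polish group acting faithfully and continuously on $X$. For $A\subseteq X$ let $G_A$ be the pointwise stabilizer of $A$ in $G$, for a finite tuple $a$ of elements of $X$ let $o(a/A)=\{ga : g\in G_A\}$, let $\pi_A : G_A\to o(a/A)$ be the map $g\mapsto ga$, and write $AB$ for $A\cup B$. For finite $A,B\subseteq X$ say that - $a$ is $nm$-independent from $B$ over $A$ if $\pi_A^{-1}[o(a/AB)]$ is non-meager in $G_A=\pi_A^{-1}[o(a/A)]$; - $a$ is $\mu$-independent from $B$ over $A$ if $\mu_A(\pi_A^{-1}[o(a/AB)])>0$, where $\mu_A$ is the Haar measure on $G_A$. The $NM$-rank is the function on orbits over finite sets, with values in the ordinals together with $\infty$, such that for every ordinal $\alpha$, $NM(a/A)\ge\alpha+1$ if and only if there is a finite $B\supseteq A$ such that $a$ is not $nm$-independent from $B$ over $A$ and $NM(a/B)\ge\alpha$ (and $NM(a/A)=\infty$ if $NM(a/A)\ge\alpha$ for all ordinals $\alpha$). Suppose that $(X,G)$ is small, i.e. for every finite $A\subseteq X$ the group $G_A$ has only countably many orbits on $X$, and $nm$-stable,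 i.e. $NM(a/A)$ is an ordinal for every $a\in X$ and every finite $A\subseteq X$. Then for every finite tuple $a$ of elements of $X$ and all finite sets $A,B\subseteq X$, $a$ is $\mu$-independent from $B$ over $A$ if and only if $a$ is $nm$-independent from $B$ over $A$. -/

import Mathlib

open MeasureTheory

universe u v

/-- `G` acts on `X` with every point stabilizer closed in `G`. -/
class HasClosedStabilizers (G : Type v) (X : Type u) [Group G] [TopologicalSpace G]
    [MulAction G X] : Prop where
  isClosed_stabilizer : ∀ x : X, IsClosed (MulAction.stabilizer G x : Set G)

instance HasClosedStabilizers.of_continuousSMul {G : Type v} {X : Type u} [Group G]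
    [TopologicalSpace G] [TopologicalSpace X] [T2Space X] [MulAction G X] [ContinuousSMul G X] :
    HasClosedStabilizers G X :=
  ⟨fun _ => isClosed_eq (continuous_id.smul continuous_const) continuous_const⟩

theorem isClosed_fixingSubgroup (G : Type v) {X : Type u} [Group G] [TopologicalSpace G]
    [MulAction G X] [HasClosedStabilizers G X] (A : Set X) :
    IsClosed (fixingSubgroup G A : Set G) := by
  have h : (fixingSubgroup G A : Set G) = ⋂ x ∈ A, (MulAction.stabilizer G x : Set G) := by
    ext g
    simp [mem_fixingSubgroup_iff]
  rw [h]
  exact isClosed_biInter fun x _ => HasClosedStabilizers.isClosed_stabilizer x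

instance locallyCompactSpace_fixingSubgroup (G : Type v) {X : Type u} [Group G]
    [TopologicalSpace G] [LocallyCompactSpace G] [MulAction G X] [HasClosedStabilizers G X]
    (A : Set X) : LocallyCompactSpace (fixingSubgroup G A) :=
  (isClosed_fixingSubgroup G A).isClosedEmbedding_subtypeVal.locallyCompactSpace

/-- A `G`-set `X` is small if for every finite `A ⊆ X` the pointwise stabilizer `G_A`
(`fixingSubgroup G A`) has countably many orbits on `X`. -/
def IsSmall (G : Type v) (X : Type u) [Group G] [MulAction G X] : Prop :=
  ∀ A : Set X, A.Finite → Countable (MulAction.orbitRel.Quotient (fixingSubgroup G A) X)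

/-- The orbit `o(a/A)` of a finite tuple `a` under the pointwise stabilizer `G_A`. -/
def orbitOver (G : Type v) {X : Type u} [Group G] [MulAction G X] {n : ℕ}
    (a : Fin n → X) (A : Set X) : Set (Fin n → X) :=
  MulAction.orbit (fixingSubgroup G A) a

/-- The preimage of `o(a/AB)` under the orbit map `G_A → o(a/A)`, `g ↦ g a`,
as a subset of the topological group `G_A`. -/
def orbitPreimage (G : Type v) {X : Type u} [Group G] [MulAction G X] {n : ℕ}
    (a : Fin n → X) (A B : Set X) : Set (fixingSubgroup G A) :=
  {g | g • a ∈ orbitOver G a (A ∪ B)}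

/-- `a` is `nm`-independent from `B` over `A`: the preimage of `o(a/AB)` is non-meager
in the preimage of `o(a/A)`, which is all of `G_A` (with the subspace topology). -/
def NmIndep (G : Type v) {X : Type u} [Group G] [TopologicalSpace G] [MulAction G X] {n : ℕ}
    (a : Fin n → X) (A B : Set X) : Prop :=
  ¬ IsMeagre (orbitPreimage G a A B)

/-- `a` is `μ`-independent from `B` over `A`: the preimage of `o(a/AB)` has positive
measure for the Haar measure of the closed subgroup `G_A` of `G`. -/
def MuIndep (G : Type v) {X : Type u} [Group G] [TopologicalSpace G] [IsTopologicalGroup G]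
    [LocallyCompactSpace G] [MeasurableSpace G] [BorelSpace G] [MulAction G X]
    [HasClosedStabilizers G X] {n : ℕ} (a : Fin n → X) (A B : Set X) : Prop :=
  0 < (Measure.haar : Measure (fixingSubgroup G A)) (orbitPreimage G a A B)

/-- `NM(a/A) ≥ α`, for an ordinal `α`: for every `β < α` there is a finite `B ⊇ A` such that
`a` is not `nm`-independent from `B` over `A` and `NM(a/B) ≥ β`. -/
def NMRankGE (G : Type v) {X : Type u} [Group G] [TopologicalSpace G] [MulAction G X] {n : ℕ}
    (a : Fin n → X) (A : Set X) (α : Ordinal.{u}) : Prop :=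
  ∀ β : Ordinal.{u}, ∀ _ : β < α,
    ∃ B : Set X, B.Finite ∧ A ⊆ B ∧ ¬ NmIndep G a A B ∧ NMRankGE G a B β
termination_by α

/-- The `NM`-rank of `o(a/A)`: the largest `α` with `NM(a/A) ≥ α`, and `⊤` if
`NM(a/A) ≥ α` for all ordinals `α`. -/
noncomputable def NMRank (G : Type v) {X : Type u} [Group G] [TopologicalSpace G]
    [MulAction G X] {n : ℕ} (a : Fin n → X) (A : Set X) : WithTop Ordinal.{u} :=
  sSup {r | ∃ α : Ordinal.{u}, NMRankGE G a A α ∧ r = (α : WithTop Ordinal.{u})}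

theorem le_NMRank_iff (G : Type v) {X : Type u} [Group G] [TopologicalSpace G] [MulAction G X]
    {n : ℕ} (a : Fin n → X) (A : Set X) (α : Ordinal.{u}) :
    (α : WithTop Ordinal.{u}) ≤ NMRank G a A ↔ NMRankGE G a A α := by
  constructor
  · intro h
    rw [NMRankGE]
    intro β hβ
    have h1 : (β : WithTop Ordinal.{u}) < NMRank G a A :=
      lt_of_lt_of_le (WithTop.coe_lt_coe.mpr hβ) h
    obtain ⟨r, ⟨γ, hγ, rfl⟩, hr⟩ := lt_sSup_iff.mp h1
    rw [NMRankGE] at hγ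
    exact hγ β (WithTop.coe_lt_coe.mp hr)
  · intro h
    exact le_sSup ⟨α, h, rfl⟩

/-- The defining property of the `NM`-rank. -/
theorem succ_le_NMRank_iff (G : Type v) {X : Type u} [Group G] [TopologicalSpace G]
    [MulAction G X] {n : ℕ} (a : Fin n → X) (A : Set X) (α : Ordinal.{u}) :
    ((α + 1 : Ordinal.{u}) : WithTop Ordinal.{u}) ≤ NMRank G a A ↔
      ∃ B : Set X, B.Finite ∧ A ⊆ B ∧ ¬ NmIndep G a A B ∧
        (α : WithTop Ordinal.{u}) ≤ NMRank G a B := by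
  simp only [le_NMRank_iff]
  constructor
  · intro h
    rw [NMRankGE] at h
    exact h α (Order.lt_add_one_iff.mpr le_rfl)
  · rintro ⟨B, hB, hAB, hn, hr⟩
    rw [NMRankGE]
    intro β hβ
    refine ⟨B, hB, hAB, hn, ?_⟩
    rw [← le_NMRank_iff] at hr ⊢
    exact le_trans (WithTop.coe_le_coe.mpr (Order.lt_add_one_iff.mp hβ)) hr

/-- `nm`-stability: every `1`-orbit over a finite set has ordinal `NM`-rank. -/
def NmStable (G : Type v) (X : Type u) [Group G] [TopologicalSpace G] [MulAction G X] : Prop :=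
  ∀ (a : Fin 1 → X) (A : Set X), A.Finite → NMRank G a A ≠ ⊤

/-! By Baire category and compactness, nm-independence of `a` from `B` over `A` says that
G_{AB}·G_{Aa} is a neighbourhood of 1 in G_A. This form is symmetric and transitive, and it makes
Haar measure positive, which gives one direction. Conversely, let E, the inverse of the orbit
preimage, have positive measure while `a` depends on `B`. Smallness gives h_i near 1 with h_i a
independent over `A` from the finite set D_i collecting `A` and the earlier translates. Taking h_i
close enough to 1 keeps F_{i+1} = F_i ∩ h_i F_i of positive measure. A point x of all F_i (with F_0
= E) makes every h_i a depend on xB over `A`. But nm-stability makes xB independent from h_i a over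
D_i for large i, and transitivity gives a contradiction. -/

open Topology Pointwise Filter

/-! ### Relatively open products of subgroups -/

section Group

variable {G : Type v} [Group G] [TopologicalSpace G]

/-- The modular law for relatively open products. -/
theorem Subgroup.mul_inf_mem_nhdsWithin_one {H K L M : Subgroup G} (hMK : M ≤ K) (hKH : K ≤ H)
    (h : (M * L : Set G) ∈ 𝓝[(H : Set G)] 1) :
    (M * (K ⊓ L : Subgroup G) : Set G) ∈ 𝓝[(K : Set G)] 1 := by
  obtain ⟨U, hU, hUs⟩ := mem_nhdsWithin_iff_exists_mem_nhds_inter.mp h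
  refine mem_nhdsWithin_iff_exists_mem_nhds_inter.mpr ⟨U, hU, ?_⟩
  rintro g ⟨hg, hgK⟩
  obtain ⟨m, hm, l, hl, e⟩ := hUs ⟨hg, hKH hgK⟩
  refine ⟨m, hm, l, ⟨?_, hl⟩, e⟩
  have : l = m⁻¹ * g := by rw [← e]; simp
  rw [this]
  exact K.mul_mem (K.inv_mem (hMK hm)) hgK

variable [IsTopologicalGroup G]

/-- The map g ↦ kgl preserves both H and KL and carries 1 to kl. -/
theorem Subgroup.mul_mem_nhdsWithin_one_of_mem {H K L : Subgroup G} (hK : K ≤ H) (hL : L ≤ H)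
    {k l : G} (hk : k ∈ K) (hl : l ∈ L)
    (h : (K * L : Set G) ∈ 𝓝[(H : Set G)] (k * l)) :
    (K * L : Set G) ∈ 𝓝[(H : Set G)] 1 := by
  obtain ⟨U, hU, hUs⟩ := mem_nhdsWithin_iff_exists_mem_nhds_inter.mp h
  have hc : ContinuousAt (fun g : G => k * g * l) 1 := by fun_prop
  have hU' : (fun g : G => k * g * l) ⁻¹' U ∈ 𝓝 (1 : G) := by
    apply hc
    simpa using hU
  refine mem_nhdsWithin_iff_exists_mem_nhds_inter.mpr ⟨_, hU', ?_⟩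
  rintro g ⟨hg, hgH⟩
  obtain ⟨k', hk', l', hl', e⟩ :=
    hUs ⟨hg, H.mul_mem (H.mul_mem (hK hk) hgH) (hL hl)⟩
  refine ⟨k⁻¹ * k', K.mul_mem (K.inv_mem hk) hk', l' * l⁻¹, L.mul_mem hl' (L.inv_mem hl), ?_⟩
  have e' : k' * l' = k * g * l := e
  calc k⁻¹ * k' * (l' * l⁻¹) = k⁻¹ * (k' * l') * l⁻¹ := by group
    _ = g := by rw [e']; group

theorem Subgroup.mul_mem_nhdsWithin_one_comm {H K L : Subgroup G}
    (h : (K * L : Set G) ∈ 𝓝[(H : Set G)] 1) : (L * K : Set G) ∈ 𝓝[(H : Set G)] 1 := by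
  obtain ⟨U, hU, hUs⟩ := mem_nhdsWithin_iff_exists_mem_nhds_inter.mp h
  refine mem_nhdsWithin_iff_exists_mem_nhds_inter.mpr ⟨U⁻¹, inv_mem_nhds_one G hU, ?_⟩
  rintro g ⟨hg, hgH⟩
  obtain ⟨k, hk, l, hl, e⟩ := hUs ⟨hg, H.inv_mem hgH⟩
  refine ⟨l⁻¹, L.inv_mem hl, k⁻¹, K.inv_mem hk, ?_⟩
  have e' : k * l = g⁻¹ := e
  change l⁻¹ * k⁻¹ = g
  rw [← mul_inv_rev, e', inv_inv]

/-- Transitivity of relative openness of products of closed subgroups of a compact group. -/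
theorem Subgroup.mul_mem_nhdsWithin_one_trans [CompactSpace G] [T2Space G] {H K L M : Subgroup G}
    (hK : IsClosed (K : Set G)) (hL : IsClosed (L : Set G))
    (hKL : (K * L : Set G) ∈ 𝓝[(H : Set G)] 1)
    (hM : (M * (K ⊓ L : Subgroup G) : Set G) ∈ 𝓝[(K : Set G)] 1) :
    (M * L : Set G) ∈ 𝓝[(H : Set G)] 1 := by
  obtain ⟨W, hWo, hW1, hWs⟩ := mem_nhdsWithin.mp hM
  -- Since CL is closed and misses 1, every factorization g = kl of an element near 1 has k in W(K ∩
  -- L).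
  set C : Set G := K \ (W * (K ⊓ L : Subgroup G)) with hC
  have hCc : IsCompact C := (hK.sdiff hWo.mul_right).isCompact
  have hCL : IsClosed (C * (L : Set G)) := (hCc.mul hL.isCompact).isClosed
  have h1 : (1 : G) ∉ C * (L : Set G) := by
    rintro ⟨c, ⟨hcK, hc⟩, l, hl, e⟩
    have e' : c * l = 1 := e
    have hcL : c ∈ L := by
      rw [eq_inv_of_mul_eq_one_left e']
      exact L.inv_mem hl
    exact hc ⟨1, hW1, c, ⟨hcK, hcL⟩, one_mul c⟩
  have h2 : (C * (L : Set G))ᶜ ∈ 𝓝[(H : Set G)] 1 :=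
    mem_nhdsWithin_of_mem_nhds (hCL.isOpen_compl.mem_nhds h1)
  filter_upwards [hKL, h2] with g hg hgC
  obtain ⟨k, hk, l, hl, rfl⟩ := hg
  have hkC : k ∈ W * ((K ⊓ L : Subgroup G) : Set G) := by
    by_contra hkW
    exact hgC ⟨k, ⟨hk, hkW⟩, l, hl, rfl⟩
  obtain ⟨w, hw, t, ht, rfl⟩ := hkC
  have hwK : w ∈ K := by
    have := K.mul_mem hk (K.inv_mem ht.1)
    simpa using this
  obtain ⟨m, hm, s, hs, e⟩ := hWs ⟨hw, hwK⟩
  refine ⟨m, hm, s * t * l, L.mul_mem (L.mul_mem hs.2 ht.2) hl, ?_⟩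
  have e' : m * s = w := e
  change m * (s * t * l) = w * t * l
  rw [← e']
  group

end Group

/-- Nonmeagre independence of the sets `B` and `C` over `A`, in symmetric form. -/
def SetIndep (G : Type v) {X : Type u} [Group G] [TopologicalSpace G] [MulAction G X]
    (A B C : Set X) : Prop :=
  ((fixingSubgroup G (A ∪ B) : Set G) * fixingSubgroup G (A ∪ C)) ∈
    𝓝[(fixingSubgroup G A : Set G)] 1

/-! ### Calculus of independence -/

section SetIndep

variable {G : Type v} {X : Type u} [Group G] [MulAction G X]

theorem fixingSubgroup_union_le (A B : Set X) : fixingSubgroup G (A ∪ B) ≤ fixingSubgroup G A :=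
  fixingSubgroup_antitone G X Set.subset_union_left

theorem mem_orbitPreimage_iff {n : ℕ} {a : Fin n → X} {A B : Set X} {g : fixingSubgroup G A} :
    g ∈ orbitPreimage G a A B ↔
      (g : G) ∈ (fixingSubgroup G (A ∪ B) : Set G) * fixingSubgroup G (A ∪ Set.range a) := by
  constructor
  · rintro ⟨k, hk⟩
    refine ⟨k, k.2, (k : G)⁻¹ * g, ?_, by simp⟩
    change _ ∈ fixingSubgroup G _
    rw [fixingSubgroup_union]
    refine Subgroup.mem_inf.mpr ⟨mul_mem (inv_mem (fixingSubgroup_union_le A B k.2)) g.2, ?_⟩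
    rw [mem_fixingSubgroup_iff]
    rintro _ ⟨i, rfl⟩
    have : (k : G) • a i = (g : G) • a i := congrFun hk i
    rw [mul_smul, ← this, inv_smul_smul]
  · rintro ⟨k, hk, l, hl, e⟩
    refine ⟨⟨k, hk⟩, ?_⟩
    ext i
    change k • a i = (g : G) • a i
    have e' : k * l = g := e
    rw [← e', mul_smul, (mem_fixingSubgroup_iff G).mp hl (a i) (Or.inr ⟨i, rfl⟩)]

theorem orbitPreimage_eq {n : ℕ} (a : Fin n → X) (A B : Set X) :
    orbitPreimage G a A B = Subtype.val ⁻¹'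
      ((fixingSubgroup G (A ∪ B) : Set G) * (fixingSubgroup G (A ∪ Set.range a) : Set G)) := by
  ext g
  exact mem_orbitPreimage_iff

variable [TopologicalSpace G]

theorem SetIndep.mono_left {A B B' C : Set X} (h : SetIndep G A B C) (hB : B' ⊆ B) :
    SetIndep G A B' C :=
  mem_of_superset h (Set.mul_subset_mul_right
    (fixingSubgroup_antitone G X (Set.union_subset_union_right A hB)))

theorem SetIndep.base_union {A B C D : Set X} (h : SetIndep G A (B ∪ C) D) :
    SetIndep G (A ∪ B) C D := by
  have := Subgroup.mul_inf_mem_nhdsWithin_one (K := fixingSubgroup G (A ∪ B))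
    (fixingSubgroup_antitone G X (Set.union_subset_union_right A Set.subset_union_left))
    (fixingSubgroup_union_le A B) h
  unfold SetIndep
  rw [← fixingSubgroup_union] at this
  convert this using 4
  · rw [Set.union_assoc]
  · ext; simp; tauto

theorem orbitPreimage_mem_nhds_one {n : ℕ} {a : Fin n → X} {A B : Set X}
    (h : SetIndep G A B (Set.range a)) :
    orbitPreimage G a A B ∈ 𝓝 (1 : fixingSubgroup G A) := by
  rw [orbitPreimage_eq]
  exact preimage_coe_mem_nhds_subtype.mpr h

variable [IsTopologicalGroup G]

theorem SetIndep.symm {A B C : Set X} (h : SetIndep G A B C) : SetIndep G A C B :=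
  Subgroup.mul_mem_nhdsWithin_one_comm h

theorem SetIndep.mono_right {A B C C' : Set X} (h : SetIndep G A B C) (hC : C' ⊆ C) :
    SetIndep G A B C' :=
  (h.symm.mono_left hC).symm

theorem SetIndep.trans [CompactSpace G] [T2Space G] [HasClosedStabilizers G X]
    {A B C D : Set X} (h : SetIndep G A B D) (h' : SetIndep G (A ∪ B) C D) :
    SetIndep G A (B ∪ C) D := by
  have := Subgroup.mul_mem_nhdsWithin_one_trans (M := fixingSubgroup G (A ∪ B ∪ C))
    (isClosed_fixingSubgroup G (A ∪ B))
    (isClosed_fixingSubgroup G (A ∪ D)) h (by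
      rw [← fixingSubgroup_union]
      unfold SetIndep at h'
      convert h' using 4
      ext; simp; tauto)
  unfold SetIndep
  rwa [← Set.union_assoc]

theorem setIndep_of_orbitPreimage_mem_nhds {n : ℕ} {a : Fin n → X} {A B : Set X}
    {g : fixingSubgroup G A} (h : orbitPreimage G a A B ∈ 𝓝 g) :
    SetIndep G A B (Set.range a) := by
  obtain ⟨k, hk, l, hl, e⟩ := mem_orbitPreimage_iff.mp (mem_of_mem_nhds h)
  rw [orbitPreimage_eq] at h
  have h' := preimage_coe_mem_nhds_subtype.mp h
  have e' : k * l = g := e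
  rw [← e'] at h'
  exact Subgroup.mul_mem_nhdsWithin_one_of_mem (fixingSubgroup_union_le _ _)
    (fixingSubgroup_union_le _ _) hk hl h'

variable [CompactSpace G] [T2Space G] [HasClosedStabilizers G X]

instance compactSpace_fixingSubgroup (A : Set X) : CompactSpace (fixingSubgroup G A) :=
  isCompact_iff_compactSpace.mp (isClosed_fixingSubgroup G A).isCompact

theorem isClosed_orbitPreimage {n : ℕ} (a : Fin n → X) (A B : Set X) :
    IsClosed (orbitPreimage G a A B) := by
  rw [orbitPreimage_eq]
  exact (((isClosed_fixingSubgroup G (A ∪ B)).isCompact.mul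
    (isClosed_fixingSubgroup G (A ∪ Set.range a)).isCompact).isClosed).preimage continuous_subtype_val

/-- The orbit preimage is closed in a Baire group, so non-meagre means nonempty interior; an
interior point can be translated to 1. -/
theorem nmIndep_iff_setIndep {n : ℕ} {a : Fin n → X} {A B : Set X} :
    NmIndep G a A B ↔ SetIndep G A B (Set.range a) := by
  constructor
  · intro h
    have : (interior (orbitPreimage G a A B)).Nonempty := by
      by_contra hne
      exact h ((isClosed_orbitPreimage a A B).isNowhereDense_iff.mpr
        (Set.not_nonempty_iff_eq_empty.mp hne)).isMeagre
    obtain ⟨g, hg⟩ := this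
    exact setIndep_of_orbitPreimage_mem_nhds (mem_interior_iff_mem_nhds.mp hg)
  · intro h hm
    exact not_isMeagre_of_isOpen isOpen_interior
      ⟨1, mem_interior_iff_mem_nhds.mpr (orbitPreimage_mem_nhds_one h)⟩ (hm.mono interior_subset)

end SetIndep

/-! ### Ranks and nm-stability -/

section Rank

variable {G : Type v} {X : Type u} [Group G] [TopologicalSpace G] [IsTopologicalGroup G]
  [MulAction G X] [CompactSpace G] [T2Space G] [HasClosedStabilizers G X]

/-- A set witnessing dependence over `A'` also does so over `A`, because independence survives
enlarging the base inside `B`. -/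
theorem NMRank_antitone {n : ℕ} (a : Fin n → X) {A A' : Set X} (h : A ⊆ A') :
    NMRank G a A' ≤ NMRank G a A := by
  refine sSup_le ?_
  rintro r ⟨α, hα, rfl⟩
  rw [le_NMRank_iff, NMRankGE]
  rw [NMRankGE] at hα
  intro β hβ
  obtain ⟨B, hB, hAB, hn, hr⟩ := hα β hβ
  refine ⟨B, hB, h.trans hAB, fun hi => hn ?_, hr⟩
  rw [nmIndep_iff_setIndep] at hi ⊢
  have h1 : SetIndep G (A ∪ A') B (Set.range a) := by
    apply SetIndep.base_union
    rwa [Set.union_eq_self_of_subset_left hAB]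
  rwa [Set.union_eq_self_of_subset_left h] at h1

theorem NMRank_lt_of_not_nmIndep {n : ℕ} {a : Fin n → X} {A B : Set X} (hB : B.Finite)
    (hAB : A ⊆ B) (hn : ¬ NmIndep G a A B) (hA : NMRank G a A ≠ ⊤) :
    NMRank G a B < NMRank G a A := by
  have hle := NMRank_antitone (G := G) a hAB
  have hBtop : NMRank G a B ≠ ⊤ := fun e => hA (top_le_iff.mp (e ▸ hle))
  obtain ⟨α, hα⟩ := WithTop.ne_top_iff_exists.mp hBtop
  rw [← hα]
  refine lt_of_lt_of_le (WithTop.coe_lt_coe.mpr (Order.lt_add_one_iff.mpr le_rfl))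
    ((succ_le_NMRank_iff G a A α).mpr ⟨B, hB, hAB, hn, hα.le⟩)

/-- In an `nm`-stable structure a finite set depends on only finitely many steps of an increasing
sequence of finite sets. -/
theorem NmStable.eventually_setIndep (hstable : NmStable G X) {C : Set X} (hC : C.Finite) :
    ∀ D e : ℕ → Set X, (∀ i, (D i).Finite) → (∀ i, D i ⊆ D (i + 1)) →
      (∀ i, e i ⊆ D (i + 1)) → ∀ᶠ i in atTop, SetIndep G (D i) C (e i) := by
  induction C, hC using Set.Finite.induction_on with
  | empty =>
    intro D e _ _ _
    refine Eventually.of_forall fun i => ?_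
    unfold SetIndep
    rw [Set.union_empty]
    exact mem_of_superset self_mem_nhdsWithin
      fun g hg => ⟨g, hg, 1, (fixingSubgroup G (D i ∪ e i)).one_mem, mul_one g⟩
  | @insert c C _ hC ih =>
    intro D e hD hmono he
    have hmono' : ∀ i, D i ∪ C ⊆ D (i + 1) ∪ C := fun i => Set.union_subset_union_left C (hmono i)
    -- A decreasing sequence of ranks stabilizes, while a dependence of `c` on `e i` over `D i ∪ C`
    -- would make it drop at step i.
    have hanti : Antitone fun i => NMRank G (fun _ : Fin 1 => c) (D i ∪ C) :=
      antitone_nat_of_succ_le fun i => NMRank_antitone _ (hmono' i)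
    obtain ⟨N, hN⟩ := WellFoundedGT.monotone_chain_condition
      (α := (WithTop Ordinal.{u})ᵒᵈ) ⟨_, hanti⟩
    filter_upwards [ih D e hD hmono he, eventually_ge_atTop N] with i hi hNi
    rw [Set.insert_eq, Set.union_comm]
    refine hi.trans ?_
    by_contra hni
    have hn : ¬ NmIndep G (fun _ : Fin 1 => c) (D i ∪ C) (D (i + 1) ∪ C) := by
      rw [nmIndep_iff_setIndep, Set.range_const]
      exact fun h => hni (h.symm.mono_right ((he i).trans Set.subset_union_left))
    have hlt := NMRank_lt_of_not_nmIndep ((hD (i + 1)).union hC) (hmono' i) hn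
      (hstable _ _ ((hD i).union hC))
    exact hlt.ne ((hN (i + 1) (hNi.trans i.le_succ)).symm.trans (hN i hNi))

end Rank

/-! ### Smallness for tuples -/

section Small

variable {G : Type v} {X : Type u} [Group G] [MulAction G X]

/-- Move the first coordinate to an orbit representative x, then treat the tail over A ∪ {x}. -/
theorem IsSmall.exists_countable_tuples (hsmall : IsSmall G X) (n : ℕ) :
    ∀ A : Set X, A.Finite → ∃ S : Set (Fin n → X), S.Countable ∧
      ∀ a, ∃ b ∈ S, ∃ g ∈ fixingSubgroup G A, g • b = a := by
  induction n with
  | zero =>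
    intro A _
    exact ⟨Set.univ, Set.countable_univ, fun a => ⟨a, trivial, 1, one_mem _, one_smul _ a⟩⟩
  | succ n ih =>
    intro A hA
    have := hsmall A hA
    let rep : MulAction.orbitRel.Quotient (fixingSubgroup G A) X → X := Quotient.out
    choose S hS hSrep using fun x : X => ih (A ∪ {x}) (hA.union (Set.finite_singleton x))
    refine ⟨⋃ q, Fin.cons (α := fun _ => X) (rep q) '' S (rep q),
      Set.countable_iUnion fun q => (hS _).image _, fun a => ?_⟩
    obtain ⟨g, hg⟩ : ∃ g : fixingSubgroup G A, g • rep (Quotient.mk'' (a 0)) = a 0 := by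
      have h : (Quotient.mk'' (rep (Quotient.mk'' (a 0))) :
        MulAction.orbitRel.Quotient (fixingSubgroup G A) X) = Quotient.mk'' (a 0) :=
          Quotient.out_eq _
      exact MulAction.orbitRel_apply.mp (Quotient.exact h.symm)
    set x := rep (Quotient.mk'' (a 0))
    have hg' : (g : G) • x = a 0 := hg
    obtain ⟨b, hb, k, hk, hkb⟩ := hSrep x ((g : G)⁻¹ • Fin.tail a)
    refine ⟨Fin.cons x b, Set.mem_iUnion.mpr ⟨_, b, hb, rfl⟩, g * k,
      mul_mem g.2 (fixingSubgroup_union_le A {x} hk), ?_⟩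
    ext i
    refine Fin.cases ?_ (fun j => ?_) i
    · have : k • x = x := (mem_fixingSubgroup_iff G).mp hk x (Or.inr rfl)
      simp [mul_smul, this, hg']
    · have := congrFun hkb j
      simp only [Pi.smul_apply] at this
      simp [mul_smul, this, Fin.tail]

end Small

/-! ### Translates of sets of positive measure -/

theorem MeasureTheory.Measure.exists_nhds_one_measure_inter_smul_pos {H : Type*} [Group H]
    [TopologicalSpace H] [IsTopologicalGroup H] [MeasurableSpace H] [BorelSpace H] (μ : Measure H)
    [μ.IsMulLeftInvariant] [μ.OuterRegular] [IsFiniteMeasureOnCompacts μ] {F : Set H}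
    (hF : IsCompact F) (hFc : IsClosed F) (hpos : 0 < μ F) :
    ∃ U ∈ 𝓝 (1 : H), ∀ h ∈ U, 0 < μ (F ∩ h • F) := by
  have hfin : μ F ≠ ⊤ := hF.measure_lt_top.ne
  -- V has measure below 2 μ F, too small for two almost disjoint translates of F.
  obtain ⟨V, hFV, hV, hμV⟩ := F.exists_isOpen_lt_add hfin hpos.ne'
  obtain ⟨U, hU, hUV⟩ := compact_open_separated_mul_left hF hV hFV
  refine ⟨U, hU, fun h hh => pos_iff_ne_zero.mpr fun h0 => ?_⟩
  have hsub : F ∪ h • F ⊆ V := by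
    refine Set.union_subset hFV ?_
    rintro _ ⟨x, hx, rfl⟩
    exact hUV ⟨h, hh, x, hx, rfl⟩
  have hm : MeasurableSet (h • F) := (hFc.smul h).measurableSet
  have := measure_union_add_inter (μ := μ) F hm
  rw [h0, add_zero, measure_smul] at this
  exact absurd hμV (not_lt.mpr (this ▸ measure_mono hsub))

/-! ### Independent translates -/

section

variable {G : Type v} {X : Type u} [Group G] [TopologicalSpace G] [IsTopologicalGroup G]
  [MulAction G X]

/-- A translate of `a` depends on `x • B` over `A` whenever `a` depends on `B` and the translate
lies in the translate by `x` of the orbit of `a` over `A ∪ B`. -/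
theorem SetIndep.of_smul {n : ℕ} {a : Fin n → X} {A B : Set X} {x h : fixingSubgroup G A}
    (hx : x⁻¹ * h ∈ orbitPreimage G a A B)
    (hi : SetIndep G A ((x : G) • B) (Set.range ((h : G) • a))) :
    SetIndep G A B (Set.range a) := by
  have h1 := orbitPreimage_mem_nhds_one hi
  -- Conjugation by x turns the stabilizer of A ∪ xB into that of A ∪ B; right translation by x⁻¹h
  -- then moves the neighbourhood from 1 to x⁻¹h.
  have hc : ContinuousAt (fun g => x * g * x⁻¹) (1 : fixingSubgroup G A) := by fun_prop
  have h2 : (fun g => x * g * x⁻¹) ⁻¹' orbitPreimage G ((h : G) • a) A ((x : G) • B) ∈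
      𝓝 (1 : fixingSubgroup G A) := by
    apply hc
    simpa using h1
  have hc' : ContinuousAt (fun g => g * (h⁻¹ * x)) (x⁻¹ * h) := by fun_prop
  have h3 := hc' (by simpa [mul_assoc] using h2)
  refine setIndep_of_orbitPreimage_mem_nhds (mem_of_superset h3 ?_)
  rintro g ⟨k, hk⟩
  have hk' : (k : G) • (h : G) • a =
      ((x : G) * (((g : G) * ((h : G)⁻¹ * x)) * (x : G)⁻¹)) • (h : G) • a := hk
  have hkx : (x : G)⁻¹ * k * x ∈ fixingSubgroup G (A ∪ B) := by
    rw [mem_fixingSubgroup_iff]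
    rintro y (hy | hy)
    · exact (mem_fixingSubgroup_iff G).mp
        (mul_mem (mul_mem (inv_mem x.2) (fixingSubgroup_union_le _ _ k.2)) x.2) y hy
    · rw [mul_smul, mul_smul, (mem_fixingSubgroup_iff G).mp k.2 ((x : G) • y)
        (Or.inr (Set.smul_mem_smul_set hy)), inv_smul_smul]
  obtain ⟨l, hl⟩ := hx
  have hl' : (l : G) • a = ((x : G)⁻¹ * (h : G)) • a := hl
  refine ⟨⟨_, hkx⟩ * l, ?_⟩
  change ((x : G)⁻¹ * k * x * l) • a = (g : G) • a
  rw [mul_smul, hl', smul_smul]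
  have e : ((x : G)⁻¹ * k * x * ((x : G)⁻¹ * h)) • a = (x : G)⁻¹ • (k : G) • (h : G) • a := by
    simp [smul_smul, mul_assoc]
  rw [e, hk']
  simp [smul_smul, mul_assoc]

variable [CompactSpace G] [T2Space G] [HasClosedStabilizers G X]

/-- The countably many orbits over A ∪ D split the interior of U, so one piece is non-meagre; any h
in that piece works. -/
theorem IsSmall.exists_setIndep_smul_mem (hsmall : IsSmall G X) {n : ℕ} (a : Fin n → X)
    {A D : Set X} (hA : A.Finite) (hD : D.Finite) {U : Set (fixingSubgroup G A)}
    (hU : U ∈ 𝓝 1) : ∃ h ∈ U, SetIndep G A D (Set.range ((h : G) • a)) := by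
  obtain ⟨S, hS, hSrep⟩ := hsmall.exists_countable_tuples n (A ∪ D) (hA.union hD)
  have := hS.to_subtype
  let f : S → Set (fixingSubgroup G A) :=
    fun b => interior U ∩ {h | ∃ k ∈ fixingSubgroup G (A ∪ D), k • (b : Fin n → X) = (h : G) • a}
  have hf : ∃ b, ¬ IsMeagre (f b) := by
    by_contra! hall
    refine not_isMeagre_of_isOpen (s := interior U) isOpen_interior
      ⟨1, mem_interior_iff_mem_nhds.mpr hU⟩ ((isMeagre_iUnion hall).mono fun h hh => ?_)
    obtain ⟨b, hb, k, hk, e⟩ := hSrep ((h : G) • a)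
    exact Set.mem_iUnion.mpr ⟨⟨b, hb⟩, hh, k, hk, e⟩
  obtain ⟨b, hb⟩ := hf
  obtain ⟨h₀, hh₀, k₀, hk₀, e₀⟩ := nonempty_of_not_isMeagre hb
  refine ⟨h₀, interior_subset hh₀, ?_⟩
  set P := (fun h => h * h₀⁻¹) ⁻¹' orbitPreimage G ((h₀ : G) • a) A D with hP
  have hfP : f b ⊆ P := by
    rintro h ⟨-, k, hk, e⟩
    refine ⟨⟨k * k₀⁻¹, mul_mem hk (inv_mem hk₀)⟩, ?_⟩
    change (k * k₀⁻¹) • (h₀ : G) • a = ((h : G) * (h₀ : G)⁻¹) • (h₀ : G) • a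
    rw [← e₀, mul_smul, inv_smul_smul, e, e₀, mul_smul, inv_smul_smul]
  have hPc : IsClosed P := (isClosed_orbitPreimage _ A D).preimage (continuous_mul_const _)
  have hne : (interior P).Nonempty := by
    by_contra hne
    exact hb ((hPc.isNowhereDense_iff.mpr
      (Set.not_nonempty_iff_eq_empty.mp hne)).isMeagre.mono hfP)
  obtain ⟨g, hg⟩ := hne
  refine setIndep_of_orbitPreimage_mem_nhds (g := g * h₀⁻¹) ?_
  have := (Homeomorph.mulRight h₀⁻¹).map_nhds_eq g
  rw [Homeomorph.coe_mulRight] at this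
  rw [← this]
  exact mem_interior_iff_mem_nhds.mp hg

end

/-! ### Comparison of measure and category -/

section

variable {G : Type v} {X : Type u} [Group G] [TopologicalSpace G] [IsTopologicalGroup G]
  [MulAction G X] [CompactSpace G] [T2Space G] [HasClosedStabilizers G X]
  [MeasurableSpace G] [BorelSpace G]

theorem MuIndep.of_nmIndep {n : ℕ} {a : Fin n → X} {A B : Set X} (h : NmIndep G a A B) :
    MuIndep G a A B :=
  Measure.measure_pos_of_mem_nhds _ (orbitPreimage_mem_nhds_one (nmIndep_iff_setIndep.mp h))

theorem MuIndep.nmIndep [SecondCountableTopology G] (hsmall : IsSmall G X)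
    (hstable : NmStable G X) {n : ℕ} {a : Fin n → X} {A B : Set X} (hA : A.Finite)
    (hB : B.Finite) (hμ : MuIndep G a A B) : NmIndep G a A B := by
  rw [nmIndep_iff_setIndep]
  by_contra hni
  let μ : Measure (fixingSubgroup G A) := Measure.haar
  -- Inverting makes x ∈ hE equivalent to x⁻¹h lying in the orbit preimage, the hypothesis of
  -- `SetIndep.of_smul`.
  set E := (orbitPreimage G a A B)⁻¹ with hE
  have hEc : IsClosed E := (isClosed_orbitPreimage a A B).inv
  have hEpos : 0 < μ E := by
    have : SecondCountableTopology (fixingSubgroup G A) :=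
      TopologicalSpace.Subtype.secondCountableTopology _
    have : MeasurableMul₂ (fixingSubgroup G A) := ContinuousMul.measurableMul₂
    rw [pos_iff_ne_zero, hE, Ne, measure_inv_null]
    exact hμ.ne'
  let State := {p : Set X × Set (fixingSubgroup G A) // p.1.Finite ∧ IsClosed p.2 ∧ 0 < μ p.2}
  have step : ∀ p : State, ∃ h : fixingSubgroup G A, ∃ q : State,
      q.1.1 = p.1.1 ∪ Set.range ((h : G) • a) ∧ q.1.2 = p.1.2 ∩ h • p.1.2 ∧
      SetIndep G A p.1.1 (Set.range ((h : G) • a)) := by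
    rintro ⟨⟨D, F⟩, hD, hF, hpos⟩
    obtain ⟨U, hU, hUF⟩ := μ.exists_nhds_one_measure_inter_smul_pos hF.isCompact hF hpos
    obtain ⟨h, hhU, hi⟩ := hsmall.exists_setIndep_smul_mem a hA hD hU
    exact ⟨h, ⟨⟨D ∪ Set.range ((h : G) • a), F ∩ h • F⟩, hD.union (Set.finite_range _),
      hF.inter (hF.smul h), hUF h hhU⟩, rfl, rfl, hi⟩
  choose h next hD hF hi using step
  -- Starting from D = A keeps A inside every D, so that D can serve as the intermediate base in
  -- transitivity.
  let s : ℕ → State := fun i => Nat.rec ⟨⟨A, E⟩, hA, hEc, hEpos⟩ (fun _ p => next p) i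
  have hs : ∀ i, s (i + 1) = next (s i) := fun _ => rfl
  have hDmono : ∀ i, (s i).1.1 ⊆ (s (i + 1)).1.1 := fun i => by
    rw [hs, hD]; exact Set.subset_union_left
  have hAD : ∀ i, A ⊆ (s i).1.1 := fun i =>
    monotone_nat_of_le_succ (f := fun i => (s i).1.1) hDmono i.zero_le
  have hFanti : ∀ i, (s (i + 1)).1.2 ⊆ (s i).1.2 := fun i => by
    rw [hs, hF]; exact Set.inter_subset_left
  have hFE : ∀ i, (s i).1.2 ⊆ E := fun i =>
    antitone_nat_of_succ_le (f := fun i => (s i).1.2) hFanti i.zero_le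
  obtain ⟨x, hx⟩ := IsCompact.nonempty_iInter_of_sequence_nonempty_isCompact_isClosed
    (fun i => (s i).1.2) hFanti (fun i => nonempty_of_measure_ne_zero (s i).2.2.2.ne')
    (s 0).2.2.1.isCompact (fun i => (s i).2.2.1)
  rw [Set.mem_iInter] at hx
  have hdep : ∀ i, ¬ SetIndep G A ((x : G) • B) (Set.range ((h (s i) : G) • a)) := by
    intro i hi'
    refine hni (hi'.of_smul ?_)
    -- Stage i + 1 places x in h_i F_i, hence in h_i E.
    have hxi := hx (i + 1)
    rw [hs, hF] at hxi
    have := hFE i (Set.mem_smul_set_iff_inv_smul_mem.mp hxi.2)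
    rw [hE, Set.mem_inv] at this
    simpa using this
  obtain ⟨i, hev⟩ := (hstable.eventually_setIndep (C := (x : G) • B) (hB.smul_set)
    (fun i => (s i).1.1) (fun i => Set.range ((h (s i) : G) • a)) (fun i => (s i).2.1) hDmono
    (fun i => by rw [hs, hD]; exact Set.subset_union_right)).exists
  have htr := (hi (s i)).trans (C := (x : G) • B) (by
    rwa [Set.union_eq_self_of_subset_left (hAD i)])
  exact hdep i (htr.mono_left Set.subset_union_right)

end

theorem mainTheorem10 {X : Type u} {G : Type v}
    [MetricSpace X] [CompactSpace X]
    [Group G] [TopologicalSpace G] [IsTopologicalGroup G] [PolishSpace G] [CompactSpace G]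
    [MeasurableSpace G] [BorelSpace G]
    [MulAction G X] [FaithfulSMul G X] [ContinuousSMul G X]
    (hsmall : IsSmall G X) (hstable : NmStable G X)
    {n : ℕ} (a : Fin n → X) (A B : Set X) (hA : A.Finite) (hB : B.Finite) :
    MuIndep G a A B ↔ NmIndep G a A B :=
  ⟨fun h => h.nmIndep hsmall hstable hA hB, MuIndep.of_nmIndep⟩
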